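/- Let $(X,\|\cdot\|)$ be a complex Banach space and let $I=\mathbb{R}$ or $I=[0,\infty)$. Let $f:I\to X$ be continuous. For $\epsilon>0$, an $\epsilon$-period (respectively $\epsilon$-antiperiod) of $f$ is a number $\tau\in I\setminus\{0\}$ such that $\|f(t+\tau)-f(t)\|\le\epsilon$ (respectively $\|f(t+\tau)+f(t)\|\le\epsilon$) for all $t\in I$. The function $f$ is called almost periodic (respectively almost anti-periodic) if for every $\epsilon>0$ the set of its $\epsilon$-periods (respectively $\epsilon$-antiperiods) is relatively dense in $I$, that is, there is $l>0$ such that every closed subinterval of $I$ of length $l$ meets this set. Let $AP(I:X)$ be the space of almost periodic functions $I\to X$ with the sup-norm. For $f\in AP(I:X)$ and $r\in\mathbb{R}$ the limit $$P_r(f)=\lim_{t\to\infty}\frac1t\int_0^t e^{-irs}f(s)\,ds$$ exists; put $\sigma(f)=\{r\in\mathbb{R}: P_r(f)\neq 0\}$, and for $\Lambda\subseteq\mathbb{R}$ put $AP_\Lambda(I:X)=\{f\in AP(I:X):\sigma(f)\subseteq\Lambda\}$. Let $ANP_0(I:X)$ be the complex linear span of the almost anti-periodic functions $I\to X$, and let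 $ANP(I:X)$ be the closure of $ANP_0(I:X)$ in $AP(I:X)$. **Theorem 2.5.** $ANP(I:X)=AP_{\mathbb{R}\setminus\{0\}}(I:X)$. In other words, an almost periodic function $f:I\to X$ is a uniform limit of linear combinations of almost anti-periodic functions if and only if $P_0(f)=0$. -/

import Mathlib

open Filter Topology

namespace AlmostAnti

/- The domain `I` is an additive submonoid of `ℝ`, so that `t + τ` makes sense in `I`. Only the
two cases `I = ⊤`, the real line, and `I = AddSubmonoid.nonneg ℝ`, the half-line `[0, ∞)`, are
ever used. -/

/-- The set `S ⊆ I` is relatively dense in `I`: there is `l > 0` such that every subinterval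
`[a, a + l]` of `I` meets `S`. -/
def RelativelyDense (I : AddSubmonoid ℝ) (S : Set I) : Prop :=
  ∃ l : ℝ, 0 < l ∧ ∀ a : I, ∃ τ ∈ S, (a : ℝ) ≤ (τ : ℝ) ∧ (τ : ℝ) ≤ (a : ℝ) + l

section Defs

variable {I : AddSubmonoid ℝ} {X : Type*} [NormedAddCommGroup X]

/-- The `ε`-periods of `f`: the nonzero `τ ∈ I` with `‖f (t + τ) - f t‖ ≤ ε` on `I`. On the
half-line these are positive; on the real line both signs are allowed. -/
def periods (f : C(I, X)) (ε : ℝ) : Set I :=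
  {τ | τ ≠ 0 ∧ ∀ t : I, ‖f (t + τ) - f t‖ ≤ ε}

/-- The `ε`-antiperiods of `f`: the nonzero `τ ∈ I` with `‖f (t + τ) + f t‖ ≤ ε` on `I`. -/
def antiperiods (f : C(I, X)) (ε : ℝ) : Set I :=
  {τ | τ ≠ 0 ∧ ∀ t : I, ‖f (t + τ) + f t‖ ≤ ε}

/-- Almost periodicity in the sense of Bohr. -/
def IsAlmostPeriodic (f : C(I, X)) : Prop :=
  ∀ ε : ℝ, 0 < ε → RelativelyDense I (periods f ε)

/-- Almost anti-periodicity. -/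
def IsAlmostAntiPeriodic (f : C(I, X)) : Prop :=
  ∀ ε : ℝ, 0 < ε → RelativelyDense I (antiperiods f ε)

variable [NormedSpace ℂ X]

/-- `P_r(f) = x`, that is, `(1 / t) ∫_0^t e^{-irs} f(s) ds` converges to `x` as `t → ∞`. The
function `f` is extended by zero outside `I`; this has no effect because `[0, t] ⊆ I`. -/
def HasBohrTransform (f : C(I, X)) (r : ℝ) (x : X) : Prop :=
  Tendsto (fun t : ℝ => (1 / t) • ∫ s in (0 : ℝ)..t,
      Complex.exp (-(Complex.I * (r : ℂ) * (s : ℂ))) •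
        Function.extend (fun u : I => (u : ℝ)) (fun u : I => f u) 0 s)
    atTop (𝓝 x)

/-- The Bohr spectrum `σ(f)`, the set of all real `r` for which `P_r(f) = 0` fails. -/
def bohrSpectrum (f : C(I, X)) : Set ℝ :=
  {r | ¬ HasBohrTransform f r 0}

end Defs

section Spaces

variable (I : AddSubmonoid ℝ) (X : Type*) [NormedAddCommGroup X] [NormedSpace ℂ X]

/-- The set `AP(I : X)` of almost periodic functions. -/
def AP : Set C(I, X) := {f | IsAlmostPeriodic f}

/-- The set `AP_Λ(I : X)` of almost periodic functions with Bohr spectrum contained in `Λ`. -/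
def APSpec (Λ : Set ℝ) : Set C(I, X) := {f | f ∈ AP I X ∧ bohrSpectrum f ⊆ Λ}

/-- `ANP₀(I : X)`, the complex linear span of the almost anti-periodic functions. -/
def ANP₀ : Submodule ℂ C(I, X) :=
  Submodule.span ℂ {f : C(I, X) | IsAlmostAntiPeriodic f}

/-- `ANP(I : X)`, the closure of `ANP₀(I : X)` in `AP(I : X)` for the sup-norm. (The topology
that Mathlib puts on `C(I, X)`, uniform convergence on compact sets, is not used.) -/
def ANP : Set C(I, X) :=
  {f | f ∈ AP I X ∧ ∀ ε : ℝ, 0 < ε → ∃ g ∈ ANP₀ I X, ∀ t : I, ‖f t - g t‖ ≤ ε}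

end Spaces

end AlmostAnti

/-! An almost anti-periodic function has mean value zero
(`AlmostAnti.IsAlmostAntiPeriodic.tendsto_meanOn`): integrating `g(s + τ) + g(s)`, which is small,
gives twice the integral of `g` up to a bounded error. Means over `[0, T]` are contractive for the
sup-norm, so every function in the closure of the span also has mean zero.

Conversely, `e^{irt} x` with `r ≠ 0` is anti-periodic, so a trigonometric polynomial is an element
of the span plus a constant. If such a sum is uniformly close to `f` and `f` has mean zero, then the
constant is small and can be dropped.

The weight therefore rests on the approximation theorem,
`AlmostAnti.IsAlmostPeriodic.exists_trigPoly_norm_sub_le`, proved here by Bogolyubov's method.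
Relative density alone forces `S + S - S - S` to contain a Bohr set (`exists_bohr_subset_add_sub`):
this is finite Fourier analysis in `ZMod N`, with a number of frequencies independent of `N`,
followed by compactness. Hence the almost periods of `f` contain a Bohr set
(`AlmostAnti.IsAlmostPeriodic.exists_bohr_isTranslationBound`). Averaging `f` against a nonnegative
trigonometric kernel concentrated on that Bohr set gives a trigonometric polynomial uniformly close
to `f`. -/

/-- The exponential sum of `A` at the frequency `j`. -/
noncomputable def expSum {N : ℕ} [NeZero N] (A : Finset (ZMod N)) (j : ZMod N) : ℂ :=
  ∑ a ∈ A, ZMod.stdAddChar (j * a)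

/-! ### Bogolyubov's lemma in `ZMod N`. -/

section FiniteFourier

variable {N : ℕ} [NeZero N]

lemma sum_stdAddChar_mul (b : ZMod N) :
    ∑ j : ZMod N, ZMod.stdAddChar (j * b) = if b = 0 then (N : ℂ) else 0 := by
  have h := AddChar.sum_mulShift b (ZMod.isPrimitive_stdAddChar N)
  simpa [ZMod.card] using h

lemma conj_expSum (A : Finset (ZMod N)) (j : ZMod N) :
    (starRingEnd ℂ) (expSum A j) = ∑ a ∈ A, ZMod.stdAddChar (-(j * a)) := by
  simp only [expSum, map_sum]
  refine Finset.sum_congr rfl fun a _ => ?_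
  rw [AddChar.map_neg_eq_conj]

/-- Parseval's identity for the indicator function of `A`. -/
lemma sum_norm_sq_expSum (A : Finset (ZMod N)) :
    ∑ j : ZMod N, ‖expSum A j‖ ^ 2 = N * A.card := by
  have h : ∑ j : ZMod N, ((‖expSum A j‖ ^ 2 : ℝ) : ℂ) = N * A.card := by
    have h1 : ∀ j : ZMod N, ((‖expSum A j‖ ^ 2 : ℝ) : ℂ)
        = ∑ a ∈ A, ∑ b ∈ A, ZMod.stdAddChar (j * (a - b)) := by
      intro j
      push_cast
      rw [← Complex.mul_conj', conj_expSum, expSum, Finset.sum_mul_sum]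
      refine Finset.sum_congr rfl fun a _ => Finset.sum_congr rfl fun b _ => ?_
      rw [← AddChar.map_add_eq_mul]
      congr 1
      ring
    simp_rw [h1]
    rw [Finset.sum_comm]
    have h2 : ∀ a ∈ A, ∑ j : ZMod N, ∑ b ∈ A, ZMod.stdAddChar (j * (a - b)) = (N : ℂ) := by
      intro a ha
      rw [Finset.sum_comm]
      simp_rw [sum_stdAddChar_mul, sub_eq_zero]
      simp [ha]
    rw [Finset.sum_congr rfl h2]
    simp [mul_comm]
  exact_mod_cast h

/-- By orthogonality the sum is `N` times the number of representations of `n` as `a + b - c - d`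
with entries in `A`. -/
lemma sum_norm_pow_four_expSum_eq_zero (A : Finset (ZMod N)) (n : ZMod N)
    (hn : ∀ a ∈ A, ∀ b ∈ A, ∀ c ∈ A, ∀ d ∈ A, n ≠ a + b - c - d) :
    ∑ j : ZMod N, ((‖expSum A j‖ ^ 4 : ℝ) : ℂ) * ZMod.stdAddChar (-(j * n)) = 0 := by
  have h1 : ∀ j : ZMod N, ((‖expSum A j‖ ^ 4 : ℝ) : ℂ) * ZMod.stdAddChar (-(j * n))
      = ∑ p ∈ (A ×ˢ A) ×ˢ (A ×ˢ A),
          ZMod.stdAddChar (j * (p.1.1 + p.1.2 - p.2.1 - p.2.2 - n)) := by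
    intro j
    have h2 : ((‖expSum A j‖ ^ 4 : ℝ) : ℂ) = (expSum A j * expSum A j) *
        ((starRingEnd ℂ) (expSum A j) * (starRingEnd ℂ) (expSum A j)) := by
      have := Complex.mul_conj' (expSum A j)
      push_cast
      linear_combination (-(expSum A j * (starRingEnd ℂ) (expSum A j))
        - (‖expSum A j‖ : ℂ) ^ 2) * this
    rw [h2, conj_expSum, expSum, Finset.sum_mul_sum, Finset.sum_mul_sum, ← Finset.sum_product',
      ← Finset.sum_product', Finset.sum_mul_sum, ← Finset.sum_product', Finset.sum_mul]
    refine Finset.sum_congr rfl fun p _ => ?_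
    simp only [← AddChar.map_add_eq_mul]
    congr 1
    ring
  simp_rw [h1]
  rw [Finset.sum_comm]
  refine Finset.sum_eq_zero fun p hp => ?_
  rw [sum_stdAddChar_mul, if_neg]
  simp only [Finset.mem_product] at hp
  intro h
  exact hn _ hp.1.1 _ hp.1.2 _ hp.2.1 _ hp.2.2 (sub_eq_zero.1 h).symm

open Classical in
/-- The frequencies at which the exponential sum of `A` is large. -/
noncomputable def largeSpectrum (A : Finset (ZMod N)) : Finset (ZMod N) :=
  {j | (A.card : ℝ) ^ 3 ≤ 2 * N * ‖expSum A j‖ ^ 2}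

lemma mem_largeSpectrum {A : Finset (ZMod N)} {j : ZMod N} :
    j ∈ largeSpectrum A ↔ (A.card : ℝ) ^ 3 ≤ 2 * N * ‖expSum A j‖ ^ 2 := by
  simp [largeSpectrum]

/-- Chebyshev's inequality applied to Parseval. For `A` of density `δ` the bound is `2 / δ ^ 2`,
free of `N`. -/
lemma card_largeSpectrum_mul_sq_le (A : Finset (ZMod N)) (hA : A.Nonempty) :
    ((largeSpectrum A).card : ℝ) * (A.card : ℝ) ^ 2 ≤ 2 * N ^ 2 := by
  have hc : (0 : ℝ) < A.card := by exact_mod_cast hA.card_pos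
  have h1 : ((largeSpectrum A).card : ℝ) * (A.card : ℝ) ^ 3
      ≤ ∑ j ∈ largeSpectrum A, 2 * N * ‖expSum A j‖ ^ 2 := by
    rw [← nsmul_eq_mul]
    exact Finset.card_nsmul_le_sum _ _ _ fun j hj => mem_largeSpectrum.1 hj
  have h2 : ∑ j ∈ largeSpectrum A, 2 * N * ‖expSum A j‖ ^ 2
      ≤ ∑ j : ZMod N, 2 * N * ‖expSum A j‖ ^ 2 :=
    Finset.sum_le_univ_sum_of_nonneg fun j => by positivity
  rw [← Finset.mul_sum Finset.univ, sum_norm_sq_expSum] at h2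
  have h3 := h1.trans h2
  have h4 : ((largeSpectrum A).card * (A.card : ℝ) ^ 2) * A.card ≤ (2 * N ^ 2) * A.card := by
    nlinarith
  exact le_of_mul_le_mul_right h4 hc

lemma zero_mem_largeSpectrum (A : Finset (ZMod N)) : (0 : ZMod N) ∈ largeSpectrum A := by
  rw [mem_largeSpectrum]
  have h : (A.card : ℝ) ≤ N := by
    have := Finset.card_le_univ A
    rw [ZMod.card] at this
    exact_mod_cast this
  have h0 : (0 : ℝ) ≤ A.card := by positivity
  simp only [expSum, zero_mul, AddChar.map_zero_eq_one, Finset.sum_const, nsmul_eq_mul, mul_one,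
    Complex.norm_natCast]
  nlinarith [mul_nonneg h0 h0, mul_nonneg (mul_nonneg h0 h0) (sub_nonneg.2 h)]

/-- Bogolyubov's lemma in `ZMod N`: the Bohr set of the large spectrum of `A` lies in
`A + A - A - A`. -/
theorem exists_eq_add_sub_of_largeSpectrum (A : Finset (ZMod N)) (hA : A.Nonempty) (n : ZMod N)
    (hn : ∀ j ∈ largeSpectrum A, 0 ≤ (ZMod.stdAddChar (j * n)).re) :
    ∃ a ∈ A, ∃ b ∈ A, ∃ c ∈ A, ∃ d ∈ A, n = a + b - c - d := by
  classical
  by_contra! hcon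
  have hz := congrArg Complex.re (sum_norm_pow_four_expSum_eq_zero A n hcon)
  simp only [Complex.re_sum, Complex.re_ofReal_mul, Complex.zero_re, AddChar.map_neg_eq_conj,
    Complex.conj_re] at hz
  have hc : (0 : ℝ) < A.card := by exact_mod_cast hA.card_pos
  have hN : (0 : ℝ) < N := by exact_mod_cast Nat.pos_of_ne_zero (NeZero.ne N)
  -- `w j` bounds the terms outside the large spectrum. By Parseval it sums to half of the term
  -- `A.card ^ 4` at `j = 0`, so the total is positive. The summand `w 0` below offsets `- w j` at
  -- `j = 0`.
  set w : ZMod N → ℝ := fun j => (A.card : ℝ) ^ 3 / (2 * N) * ‖expSum A j‖ ^ 2 with hw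
  have hlow : ∀ j : ZMod N, (if j = 0 then (A.card : ℝ) ^ 4 + w 0 else 0) - w j
      ≤ ‖expSum A j‖ ^ 4 * (ZMod.stdAddChar (j * n)).re := by
    intro j
    by_cases h0 : j = 0
    · subst h0
      simp [expSum]
    · rw [if_neg h0, zero_sub]
      have hwj : 0 ≤ w j := by positivity
      by_cases hj : j ∈ largeSpectrum A
      · have := mul_nonneg (by positivity : (0 : ℝ) ≤ ‖expSum A j‖ ^ 4) (hn j hj)
        linarith
      · rw [mem_largeSpectrum, not_le] at hj
        have hre : -1 ≤ (ZMod.stdAddChar (j * n)).re := by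
          have h1 := Complex.abs_re_le_norm (ZMod.stdAddChar (j * n))
          rw [AddChar.norm_apply] at h1
          exact (abs_le.1 h1).1
        have h2 : ‖expSum A j‖ ^ 4 ≤ w j := by
          have : ‖expSum A j‖ ^ 2 ≤ (A.card : ℝ) ^ 3 / (2 * N) := by
            rw [le_div_iff₀ (by positivity)]
            linarith
          calc ‖expSum A j‖ ^ 4 = ‖expSum A j‖ ^ 2 * ‖expSum A j‖ ^ 2 := by ring
            _ ≤ w j := mul_le_mul_of_nonneg_right this (by positivity)
        have h3 : (0 : ℝ) ≤ ‖expSum A j‖ ^ 4 := by positivity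
        nlinarith
  have hsum := Finset.sum_le_sum fun j (_ : j ∈ Finset.univ) => hlow j
  rw [hz, Finset.sum_sub_distrib, Finset.sum_ite_eq' Finset.univ (0 : ZMod N)] at hsum
  have hwsum : ∑ j, w j = (A.card : ℝ) ^ 4 / 2 := by
    rw [hw, ← Finset.mul_sum, sum_norm_sq_expSum]
    field_simp
  have hw0 : 0 ≤ w 0 := by positivity
  simp only [Finset.mem_univ, if_true] at hsum
  have : 0 < (A.card : ℝ) ^ 4 := by positivity
  linarith

end FiniteFourier

/-! ### Bogolyubov's lemma in the integers. -/

lemma re_stdAddChar_mul_intCast {N : ℕ} [NeZero N] (j : ZMod N) (n : ℤ) :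
    (ZMod.stdAddChar (j * (n : ZMod N))).re = Real.cos (2 * Real.pi * j.val / N * n) := by
  have h : j * (n : ZMod N) = (((j.val : ℤ) * n : ℤ) : ZMod N) := by
    push_cast
    rw [ZMod.natCast_zmod_val]
  rw [h, ZMod.stdAddChar_coe]
  have h2 : (2 * Real.pi * Complex.I * (((j.val : ℤ) * n : ℤ) : ℂ) / (N : ℂ))
      = ((2 * Real.pi * j.val / N * n : ℝ) : ℂ) * Complex.I := by
    push_cast
    ring
  rw [h2, Complex.exp_ofReal_mul_I_re]

/-- A finite family of frequencies whose Bohr set, within a window of size `M`, lies in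
`S + S - S - S`; the size of the family does not depend on `M`. -/
lemma exists_frequencies_of_window {S : Set ℤ} {L : ℕ} (hL : 0 < L)
    (hS : ∀ a : ℤ, ∃ s ∈ S, a ≤ s ∧ s < a + L) {M : ℕ} (hM : 0 < M) :
    ∃ θ : Fin (128 * L ^ 2) → ℝ, (∀ j, θ j ∈ Set.Icc 0 (2 * Real.pi)) ∧
      ∀ n : ℤ, |n| ≤ M → (∀ j, 0 ≤ Real.cos (θ j * n)) →
        ∃ a ∈ S, ∃ b ∈ S, ∃ c ∈ S, ∃ d ∈ S, n = a + b - c - d := by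
  classical
  choose s hsS hs1 hs2 using hS
  -- The sums `a + b - c - d` and `n` are at most `2ML` and `M` in absolute value, so modulo `8ML` a
  -- congruence between them is an equality.
  set N : ℕ := 8 * (M * L) with hN
  have hML : 0 < M * L := Nat.mul_pos hM hL
  have : NeZero N := ⟨by omega⟩
  have hNZ : (N : ℤ) = 8 * ((M : ℤ) * L) := by rw [hN]; push_cast; ring
  have hMLM : (M : ℤ) ≤ (M : ℤ) * L := by
    have : M ≤ M * L := Nat.le_mul_of_pos_right _ hL
    exact_mod_cast this
  -- One element of `S` from each of the disjoint blocks `[iL, (i + 1)L)`: the set `A` of their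
  -- residues has exactly `M` elements, hence density `1 / (8L)`.
  set u : ℕ → ℤ := fun i => s ((i : ℤ) * L) with hu
  have hu0 : ∀ i, 0 ≤ u i := fun i => le_trans (by positivity) (hs1 _)
  have hu1 : ∀ i < M, u i < (M : ℤ) * L := by
    intro i hi
    have h1 := hs2 ((i : ℤ) * L)
    have h2 : ((i : ℤ) + 1) * L ≤ (M : ℤ) * L :=
      mul_le_mul_of_nonneg_right (by exact_mod_cast hi) (by positivity)
    calc u i < (i : ℤ) * L + L := h1
      _ = ((i : ℤ) + 1) * L := by ring
      _ ≤ _ := h2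
  have heq : ∀ x y : ℤ, |x - y| < N → (x : ZMod N) = (y : ZMod N) → x = y := by
    intro x y hxy h
    rw [ZMod.intCast_eq_intCast_iff_dvd_sub] at h
    have h1 := Int.eq_zero_of_abs_lt_dvd h (by rwa [abs_sub_comm])
    linarith
  set A : Finset (ZMod N) := (Finset.range M).image fun i => (u i : ZMod N) with hA
  have hinj : Set.InjOn (fun i => (u i : ZMod N)) (Finset.range M : Set ℕ) := by
    intro i hi j hj hij
    simp only [Finset.coe_range, Set.mem_Iio] at hi hj
    have h := heq (u i) (u j) (by
      rw [abs_lt]; constructor <;> linarith [hu0 i, hu0 j, hu1 i hi, hu1 j hj]) hij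
    have hi1 := hs1 ((i : ℤ) * L)
    have hi2 := hs2 ((i : ℤ) * L)
    have hj1 := hs1 ((j : ℤ) * L)
    have hj2 := hs2 ((j : ℤ) * L)
    simp only [hu] at h
    have hLZ : (0 : ℤ) < L := by exact_mod_cast hL
    have h3 : (i : ℤ) < j + 1 := by
      refine lt_of_mul_lt_mul_right (a := (L : ℤ)) ?_ hLZ.le
      linarith
    have h4 : (j : ℤ) < i + 1 := by
      refine lt_of_mul_lt_mul_right (a := (L : ℤ)) ?_ hLZ.le
      linarith
    omega
  have hcard : A.card = M := by rw [hA, Finset.card_image_of_injOn hinj, Finset.card_range]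
  have hAne : A.Nonempty := Finset.card_pos.1 (by omega)
  have hR : (largeSpectrum A).card ≤ 128 * L ^ 2 := by
    have h := card_largeSpectrum_mul_sq_le A hAne
    rw [hcard] at h
    have h' : (largeSpectrum A).card * M ^ 2 ≤ 2 * N ^ 2 := by exact_mod_cast h
    refine le_of_mul_le_mul_right (a := M ^ 2) ?_ (by positivity)
    calc _ ≤ 2 * N ^ 2 := h'
      _ = _ := by rw [hN]; ring
  obtain ⟨e⟩ : Nonempty (largeSpectrum A ↪ Fin (128 * L ^ 2)) :=
    Function.Embedding.nonempty_of_card_le (by simpa using hR)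
  have : Nonempty (largeSpectrum A) := ⟨⟨0, zero_mem_largeSpectrum A⟩⟩
  have hNpos : (0 : ℝ) < N := by exact_mod_cast Nat.pos_of_ne_zero (NeZero.ne N)
  -- A left inverse of the embedding `e` lists the large spectrum with repetitions, so that the
  -- index type does not depend on `M`.
  refine ⟨fun i => 2 * Real.pi * ((Function.invFun e i : largeSpectrum A) : ZMod N).val / N,
    fun i => ⟨by positivity, ?_⟩, fun n hn hcos => ?_⟩
  · rw [div_le_iff₀ hNpos]
    have : ((((Function.invFun e i : largeSpectrum A) : ZMod N).val : ℕ) : ℝ) ≤ N := by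
      exact_mod_cast (ZMod.val_lt _).le
    exact mul_le_mul_of_nonneg_left this (by positivity)
  · obtain ⟨a, ha, b, hb, c, hc, d, hd, h⟩ :=
      exists_eq_add_sub_of_largeSpectrum A hAne (n : ZMod N) (by
        intro j hj
        have h := hcos (e ⟨j, hj⟩)
        beta_reduce at h
        rw [Function.leftInverse_invFun e.injective] at h
        rwa [re_stdAddChar_mul_intCast])
    simp only [hA, Finset.mem_image, Finset.mem_range] at ha hb hc hd
    obtain ⟨a, ha, rfl⟩ := ha
    obtain ⟨b, hb, rfl⟩ := hb
    obtain ⟨c, hc, rfl⟩ := hc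
    obtain ⟨d, hd, rfl⟩ := hd
    refine ⟨u a, hsS _, u b, hsS _, u c, hsS _, u d, hsS _, heq _ _ ?_ (by exact_mod_cast h)⟩
    have := abs_le.1 hn
    rw [abs_lt]
    constructor <;>
      linarith [hu0 a, hu0 b, hu0 c, hu0 d, hu1 a ha, hu1 b hb, hu1 c hc, hu1 d hd]

/-- Bogolyubov's lemma: if `S ⊆ ℤ` is relatively dense, then `S + S - S - S` contains a Bohr
set. -/
theorem exists_bohr_subset_add_sub {S : Set ℤ} {L : ℕ} (hL : 0 < L)
    (hS : ∀ a : ℤ, ∃ s ∈ S, a ≤ s ∧ s < a + L) :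
    ∃ (k : ℕ) (θ : Fin k → ℝ), (∀ j, θ j ∈ Set.Icc 0 (2 * Real.pi)) ∧
      ∀ n : ℤ, (∀ j, 0 < Real.cos (θ j * n)) →
        ∃ a ∈ S, ∃ b ∈ S, ∃ c ∈ S, ∃ d ∈ S, n = a + b - c - d := by
  choose θ hθ hθS using fun M : ℕ => exists_frequencies_of_window hL hS (Nat.succ_pos M)
  have hK : IsCompact (Set.univ.pi fun _ : Fin (128 * L ^ 2) => Set.Icc (0 : ℝ) (2 * Real.pi)) :=
    isCompact_univ_pi fun _ => isCompact_Icc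
  obtain ⟨x, hx, φ, hφ, hlim⟩ := hK.tendsto_subseq (x := θ) fun M j _ => hθ M j
  refine ⟨_, x, fun j => hx j trivial, fun n hn => ?_⟩
  -- Strict positivity at the limit frequencies passes to the frequencies of all far windows; one
  -- containing `n` suffices.
  have hev : ∀ᶠ M in atTop, ∀ j, 0 < Real.cos (θ (φ M) j * n) := by
    rw [eventually_all]
    intro j
    have h1 : Tendsto (fun M => Real.cos (θ (φ M) j * n)) atTop (𝓝 (Real.cos (x j * n))) :=
      (Real.continuous_cos.tendsto _).comp (((tendsto_pi_nhds.1 hlim) j).mul_const _)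
    exact h1.eventually (lt_mem_nhds (hn j))
  obtain ⟨M, hM, hMn⟩ := (hev.and (eventually_ge_atTop n.natAbs)).exists
  refine hθS (φ M) n ?_ fun j => (hM j).le
  have h1 : M ≤ φ M := hφ.id_le M
  have h2 : n.natAbs ≤ (φ M).succ := (hMn.trans h1).trans (Nat.le_succ _)
  rw [Int.abs_eq_natAbs]
  exact_mod_cast h2

/-! ### Almost periods as real shifts of either sign. -/

section Domain

variable {I : AddSubmonoid ℝ}

lemma mem_of_nonneg_of_domain (hI : I = ⊤ ∨ I = AddSubmonoid.nonneg ℝ) {s : ℝ} (hs : 0 ≤ s) :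
    s ∈ I := by
  rcases hI with rfl | rfl
  · trivial
  · exact hs

/-- Two shifts can be composed in one of the two orders without leaving the half-line: do the
nonnegative one first. -/
lemma add_mem_or_add_mem_of_domain (hI : I = ⊤ ∨ I = AddSubmonoid.nonneg ℝ) {t r s : ℝ}
    (ht : t ∈ I) (h : t + r + s ∈ I) : t + r ∈ I ∨ t + s ∈ I := by
  rcases hI with rfl | rfl
  · exact Or.inl trivial
  · simp only [AddSubmonoid.mem_nonneg] at *
    rcases le_total 0 r with hr | hr
    · exact Or.inl (by linarith)
    rcases le_total 0 s with hs | hs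
    · exact Or.inr (by linarith)
    · exact Or.inl (by linarith)

end Domain

section AlmostPeriods

variable {I : AddSubmonoid ℝ} {X : Type*} [NormedAddCommGroup X]

/-- Translation by the real number `s` (of any sign) moves `f` by at most `ε` wherever both
points lie in the domain. -/
def IsTranslationBound (f : C(I, X)) (ε s : ℝ) : Prop :=
  ∀ t u : I, (u : ℝ) = t + s → ‖f u - f t‖ ≤ ε

lemma IsTranslationBound.neg {f : C(I, X)} {ε s : ℝ} (h : IsTranslationBound f ε s) :
    IsTranslationBound f ε (-s) := by
  intro t u hu
  rw [norm_sub_rev]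
  exact h u t (by rw [hu]; ring)

lemma IsTranslationBound.mono {f : C(I, X)} {ε δ s : ℝ} (h : IsTranslationBound f ε s)
    (hδ : ε ≤ δ) : IsTranslationBound f δ s :=
  fun t u hu => (h t u hu).trans hδ

lemma IsTranslationBound.add (hI : I = ⊤ ∨ I = AddSubmonoid.nonneg ℝ) {f : C(I, X)}
    {ε δ r s : ℝ} (hr : IsTranslationBound f ε r) (hs : IsTranslationBound f δ s) :
    IsTranslationBound f (ε + δ) (r + s) := by
  intro t u hu
  have hmem : (t : ℝ) + r + s ∈ I := by
    rw [add_assoc, ← hu]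
    exact u.2
  rcases add_mem_or_add_mem_of_domain hI t.2 hmem with h | h
  · have h1 := hr t ⟨_, h⟩ rfl
    have h2 := hs ⟨_, h⟩ u (by rw [hu]; ring)
    have := norm_sub_le_norm_sub_add_norm_sub (f u) (f ⟨_, h⟩) (f t)
    linarith
  · have h1 := hs t ⟨_, h⟩ rfl
    have h2 := hr ⟨_, h⟩ u (by rw [hu]; ring)
    have := norm_sub_le_norm_sub_add_norm_sub (f u) (f ⟨_, h⟩) (f t)
    linarith

lemma isTranslationBound_zero (f : C(I, X)) {ε : ℝ} (hε : 0 ≤ ε) :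
    IsTranslationBound f ε 0 := by
  intro t u hu
  have : u = t := Subtype.ext (by simpa using hu)
  simpa [this] using hε

lemma isTranslationBound_of_mem_periods {f : C(I, X)} {ε : ℝ} {τ : I}
    (h : τ ∈ AlmostAnti.periods f ε) : IsTranslationBound f ε τ := by
  intro t u hu
  have : u = t + τ := Subtype.ext (by simpa using hu)
  rw [this]
  exact h.2 t

/-- Every real interval of a fixed length contains an almost period, in the two-sided sense. -/
lemma AlmostAnti.IsAlmostPeriodic.exists_isTranslationBound
    (hI : I = ⊤ ∨ I = AddSubmonoid.nonneg ℝ) {f : C(I, X)} (hf : AlmostAnti.IsAlmostPeriodic f)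
    {ε : ℝ} (hε : 0 < ε) :
    ∃ l : ℝ, 0 < l ∧ ∀ a : ℝ, ∃ τ : ℝ, a ≤ τ ∧ τ ≤ a + l ∧ IsTranslationBound f ε τ := by
  obtain ⟨l, hl, h⟩ := hf ε hε
  refine ⟨l, hl, fun a => ?_⟩
  rcases le_total 0 a with ha | ha
  · obtain ⟨τ, hτ, h1, h2⟩ := h ⟨a, mem_of_nonneg_of_domain hI ha⟩
    exact ⟨τ, h1, h2, isTranslationBound_of_mem_periods hτ⟩
  rcases le_total 0 (a + l) with hal | hal
  -- The shift zero is admissible here, unlike in `periods`; it serves the intervals around the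
  -- origin, and reflection serves those to the left.
  · exact ⟨0, ha, hal, isTranslationBound_zero f hε.le⟩
  · obtain ⟨τ, hτ, h1, h2⟩ := h ⟨-(a + l), mem_of_nonneg_of_domain hI (by linarith)⟩
    simp only at h1 h2
    exact ⟨-τ, by linarith, by linarith, (isTranslationBound_of_mem_periods hτ).neg⟩

/-- The continuous extension to `ℝ` of the restriction of `f` to the half-line `[0, ∞)`, constant
on `(-∞, 0]`. -/
noncomputable def halfLineExt (hI : I = ⊤ ∨ I = AddSubmonoid.nonneg ℝ) (f : C(I, X)) (s : ℝ) : X :=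
  f ⟨max s 0, mem_of_nonneg_of_domain hI (le_max_right s 0)⟩

lemma continuous_halfLineExt (hI : I = ⊤ ∨ I = AddSubmonoid.nonneg ℝ) (f : C(I, X)) :
    Continuous (halfLineExt hI f) :=
  f.continuous.comp (Continuous.subtype_mk (continuous_id.max continuous_const) _)

lemma intervalIntegrable_halfLineExt (hI : I = ⊤ ∨ I = AddSubmonoid.nonneg ℝ) (f : C(I, X))
    (a b : ℝ) : IntervalIntegrable (halfLineExt hI f) MeasureTheory.volume a b :=
  (continuous_halfLineExt hI f).intervalIntegrable a b

lemma halfLineExt_coe (hI : I = ⊤ ∨ I = AddSubmonoid.nonneg ℝ) (f : C(I, X)) {t : I}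
    (ht : 0 ≤ (t : ℝ)) : halfLineExt hI f t = f t := by
  unfold halfLineExt
  congr 1
  exact Subtype.ext (max_eq_left ht)

/-- An almost periodic function is bounded. -/
lemma AlmostAnti.IsAlmostPeriodic.exists_norm_le
    (hI : I = ⊤ ∨ I = AddSubmonoid.nonneg ℝ) {f : C(I, X)} (hf : AlmostAnti.IsAlmostPeriodic f) :
    ∃ M : ℝ, 0 ≤ M ∧ ∀ t, ‖f t‖ ≤ M := by
  obtain ⟨l, hl, h⟩ := hf.exists_isTranslationBound hI one_pos
  obtain ⟨C, hC⟩ := (isCompact_Icc (a := (0 : ℝ)) (b := l)).exists_bound_of_continuousOn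
    (continuous_halfLineExt hI f).continuousOn
  have hC0 : 0 ≤ C := (norm_nonneg _).trans (hC 0 ⟨le_rfl, hl.le⟩)
  refine ⟨C + 1, by linarith, fun t => ?_⟩
  -- An almost period in `[t - l, t]` carries `t` back into the compact interval `[0, l]`.
  obtain ⟨τ, h1, h2, hτ⟩ := h (t - l)
  have hv0 : 0 ≤ (t : ℝ) - τ := by linarith
  set v : I := ⟨t - τ, mem_of_nonneg_of_domain hI hv0⟩ with hv
  have h3 := hτ v t (by rw [hv]; ring)
  have h4 := hC v ⟨hv0, by simp only [hv]; linarith⟩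
  rw [halfLineExt_coe hI f (t := v) hv0] at h4
  have := norm_le_norm_add_norm_sub (f v) (f t)
  rw [norm_sub_rev] at h3
  linarith

/-- An almost periodic function is uniformly continuous. -/
lemma AlmostAnti.IsAlmostPeriodic.exists_isTranslationBound_of_abs_le
    (hI : I = ⊤ ∨ I = AddSubmonoid.nonneg ℝ) {f : C(I, X)} (hf : AlmostAnti.IsAlmostPeriodic f)
    {ε : ℝ} (hε : 0 < ε) :
    ∃ η : ℝ, 0 < η ∧ ∀ s : ℝ, |s| ≤ η → IsTranslationBound f ε s := by
  obtain ⟨l, hl, h⟩ := hf.exists_isTranslationBound hI (show 0 < ε / 3 by linarith)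
  have huc := (isCompact_Icc (a := (0 : ℝ)) (b := l + 1)).uniformContinuousOn_of_continuous
    (continuous_halfLineExt hI f).continuousOn
  rw [Metric.uniformContinuousOn_iff] at huc
  obtain ⟨δ, hδ, huc⟩ := huc (ε / 3) (by linarith)
  have hpos : ∀ s : ℝ, 0 ≤ s → s ≤ min 1 (δ / 2) → IsTranslationBound f ε s := by
    intro s hs0 hs t u hu
    have hs1 := hs.trans (min_le_left _ _)
    have hs2 := hs.trans (min_le_right _ _)
    obtain ⟨τ, h1, h2, hτ⟩ := h (t - l)
    have hv0 : 0 ≤ (t : ℝ) - τ := by linarith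
    have hw0 : 0 ≤ (t : ℝ) - τ + s := by linarith
    set v : I := ⟨t - τ, mem_of_nonneg_of_domain hI hv0⟩ with hv
    set w : I := ⟨t - τ + s, mem_of_nonneg_of_domain hI hw0⟩ with hw
    have h3 := hτ v t (by rw [hv]; ring)
    have h4 := hτ w u (by rw [hw, hu]; ring)
    have h5 := huc w ⟨hw0, by simp only [hw]; linarith⟩ v ⟨hv0, by simp only [hv]; linarith⟩ (by
      simp only [hv, hw, Real.dist_eq, add_sub_cancel_left]
      rw [abs_of_nonneg hs0]
      linarith)
    rw [halfLineExt_coe hI f (t := v) hv0, halfLineExt_coe hI f (t := w) hw0, dist_eq_norm] at h5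
    have h6 := norm_sub_le_norm_sub_add_norm_sub (f u) (f w) (f t)
    have h7 := norm_sub_le_norm_sub_add_norm_sub (f w) (f v) (f t)
    rw [norm_sub_rev] at h3
    linarith
  refine ⟨min 1 (δ / 2), by positivity, fun s hs => ?_⟩
  rcases le_total 0 s with h0 | h0
  · exact hpos s h0 (by rwa [abs_of_nonneg h0] at hs)
  · have := hpos (-s) (by linarith) (by rwa [abs_of_nonpos h0] at hs)
    simpa using this.neg

/-! ### A Bohr set of almost periods. -/

lemma abs_lt_of_cos_gt {x : ℝ} (hx : |x| ≤ Real.pi) (h : √2 / 2 < Real.cos x) :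
    |x| < Real.pi / 4 := by
  by_contra! hcon
  have := Real.cos_le_cos_of_nonneg_of_le_pi (by positivity) hx hcon
  rw [Real.cos_abs, Real.cos_pi_div_four] at this
  linarith

/-- Both angles lie within `π / 4` of `2πℤ`, so their difference lies within `π / 2` of it. -/
lemma cos_sub_pos {a b : ℝ} (ha : √2 / 2 < Real.cos a) (hb : √2 / 2 < Real.cos b) :
    0 < Real.cos (a - b) := by
  rw [Real.cos_sub]
  have h2 : √2 * √2 = 2 := Real.mul_self_sqrt (by norm_num)
  have h0 : 0 < √2 := by positivity
  have h1 : 1 / 2 < Real.cos a * Real.cos b := by nlinarith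
  nlinarith [Real.sin_sq_add_cos_sq a, Real.sin_sq_add_cos_sq b,
    sq_nonneg (Real.sin a + Real.sin b), sq_nonneg (Real.cos a - Real.cos b)]

/-- The almost periods of an almost periodic function contain a Bohr set. -/
theorem AlmostAnti.IsAlmostPeriodic.exists_bohr_isTranslationBound
    (hI : I = ⊤ ∨ I = AddSubmonoid.nonneg ℝ) {f : C(I, X)} (hf : AlmostAnti.IsAlmostPeriodic f)
    {ε : ℝ} (hε : 0 < ε) :
    ∃ (k : ℕ) (l : Fin k → ℝ), ∀ s : ℝ, (∀ j, √2 / 2 < Real.cos (l j * s)) →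
      IsTranslationBound f ε s := by
  have hε9 : 0 < ε / 9 := by linarith
  obtain ⟨η, hη, huc⟩ := hf.exists_isTranslationBound_of_abs_le hI hε9
  obtain ⟨l, hl, hper⟩ := hf.exists_isTranslationBound hI hε9
  -- Rounding an almost period to the grid `ηℤ` costs a second `ε / 9`. Four elements of `S` then
  -- cost `8ε / 9`, and the last `ε / 9` pays for the distance from `s` to the grid.
  set S : Set ℤ := {n | IsTranslationBound f (ε / 9 + ε / 9) (n * η)} with hS
  obtain ⟨L, hL⟩ := exists_nat_gt (l / η + 2)
  have hLpos : 0 < L := by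
    have : (0 : ℝ) < L := lt_trans (by positivity) hL
    exact_mod_cast this
  have hdense : ∀ a : ℤ, ∃ s ∈ S, a ≤ s ∧ s < a + L := by
    intro a
    obtain ⟨τ, h1, h2, hτ⟩ := hper (a * η)
    have h3 : (a : ℝ) ≤ τ / η := by rwa [le_div_iff₀ hη]
    have h4 : τ / η ≤ a + l / η := by
      rw [div_le_iff₀ hη, add_mul, div_mul_cancel₀ _ hη.ne']
      exact h2
    refine ⟨⌊τ / η⌋, ?_, Int.le_floor.2 h3, ?_⟩
    · have h5 := Int.floor_le (τ / η)
      have h6 := Int.lt_floor_add_one (τ / η)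
      have h7 : |(⌊τ / η⌋ : ℝ) * η - τ| ≤ η := by
        have h8 : (⌊τ / η⌋ : ℝ) * η - τ = (⌊τ / η⌋ - τ / η) * η := by
          field_simp
        rw [h8, abs_mul, abs_of_pos hη]
        refine mul_le_of_le_one_left hη.le ?_
        rw [abs_le]
        constructor <;> linarith
      have := hτ.add hI (huc _ h7)
      simpa [hS] using this
    · have h5 := Int.floor_le (τ / η)
      have : (⌊τ / η⌋ : ℝ) < a + L := by linarith
      exact_mod_cast this
  obtain ⟨k, θ, hθ, hbohr⟩ := exists_bohr_subset_add_sub hLpos hdense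
  -- The extra frequency `2π / η` forces `s` to be close to a multiple of `η`.
  refine ⟨k + 1, Fin.cons (2 * Real.pi / η) fun j => θ j / η, fun s hs => ?_⟩
  rw [Fin.forall_fin_succ] at hs
  simp only [Fin.cons_zero, Fin.cons_succ] at hs
  obtain ⟨hs0, hs⟩ := hs
  set n : ℤ := round (s / η) with hn
  set r : ℝ := s / η - n with hr
  have hrle : |r| ≤ 1 / 2 := abs_sub_round (s / η)
  have hpi := Real.pi_pos
  have h1 : |2 * Real.pi * r| < Real.pi / 4 := by
    refine abs_lt_of_cos_gt ?_ ?_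
    · rw [abs_mul, abs_of_pos (by positivity)]
      nlinarith
    · have : 2 * Real.pi * r = 2 * Real.pi / η * s - n * (2 * Real.pi) := by
        rw [hr]
        ring
      rwa [this, Real.cos_sub_int_mul_two_pi]
  -- `θ j * n` is the difference of `θ j / η * s` and `θ j * r`; both have cosine above `cos (π /
  -- 4)`, the second because `θ j ≤ 2π`.
  have h2 : ∀ j, 0 < Real.cos (θ j * n) := by
    intro j
    have h3 : θ j * n = θ j / η * s - θ j * r := by
      rw [hr]
      ring
    rw [h3]
    refine cos_sub_pos (hs j) ?_
    have h4 : |θ j * r| ≤ |2 * Real.pi * r| := by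
      rw [abs_mul, abs_mul, abs_of_nonneg (hθ j).1, abs_of_pos (by positivity : 0 < 2 * Real.pi)]
      exact mul_le_mul_of_nonneg_right (hθ j).2 (abs_nonneg r)
    rw [← Real.cos_abs, ← Real.cos_pi_div_four]
    exact Real.cos_lt_cos_of_nonneg_of_le_pi (abs_nonneg _) (by linarith) (by linarith)
  obtain ⟨a, ha, b, hb, c, hc, d, hd, habcd⟩ := hbohr n h2
  simp only [hS, Set.mem_ofPred_eq] at ha hb hc hd
  have h5 := ((((ha.add hI hb).add hI hc.neg).add hI hd.neg).add hI
    (huc (r * η) (by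
      rw [abs_mul, abs_of_pos hη]
      nlinarith)))
  have h6 : (a : ℝ) * η + b * η + -(c * η) + -(d * η) + r * η = s := by
    have h7 : (n : ℝ) = a + b - c - d := by exact_mod_cast habcd
    have h8 : s = (n + r) * η := by
      rw [hr]
      field_simp
      ring
    rw [h8, h7]
    ring
  rw [h6] at h5
  exact h5.mono (by linarith)

end AlmostPeriods

/-! ### Nonnegative trigonometric kernels and their means. -/

/-- `K` is a trigonometric polynomial with nonnegative coefficients `c` at the frequencies `m`. -/
def IsNonnegTrigSum {ι : Type} [Fintype ι] (K : ℝ → ℝ) (c m : ι → ℝ) : Prop :=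
  (∀ i, 0 ≤ c i) ∧
    ∀ s : ℝ, (K s : ℂ) = ∑ i, (c i : ℂ) * Complex.exp (Complex.I * (m i : ℂ) * (s : ℂ))

open Classical in
/-- The total coefficient at frequency zero, which is the mean value of the trigonometric
polynomial. -/
noncomputable def zeroCoeff {ι : Type} [Fintype ι] (c m : ι → ℝ) : ℝ :=
  ∑ i, if m i = 0 then c i else 0

/-- `K` is a trigonometric polynomial with nonnegative coefficients and mean value at least `d`. -/
def HasNonnegTrigSum (K : ℝ → ℝ) (d : ℝ) : Prop :=
  ∃ (ι : Type) (_ : Fintype ι) (c m : ι → ℝ), IsNonnegTrigSum K c m ∧ d ≤ zeroCoeff c m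

lemma hasNonnegTrigSum_one : HasNonnegTrigSum (fun _ => 1) 1 :=
  ⟨Unit, inferInstance, fun _ => 1, fun _ => 0, ⟨fun _ => zero_le_one, fun s => by simp⟩,
    by simp [zeroCoeff]⟩

/-- Pairs of zero frequencies already contribute the product of the means. Any other cancelling pair
adds a nonnegative amount, so no independence of the frequencies is needed. -/
lemma HasNonnegTrigSum.mul {K K' : ℝ → ℝ} {d d' : ℝ} (h : HasNonnegTrigSum K d)
    (h' : HasNonnegTrigSum K' d') (hd : 0 ≤ d) (hd' : 0 ≤ d') :
    HasNonnegTrigSum (fun s => K s * K' s) (d * d') := by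
  classical
  obtain ⟨ι, _, c, m, ⟨hc, hK⟩, hz⟩ := h
  obtain ⟨ι', _, c', m', ⟨hc', hK'⟩, hz'⟩ := h'
  refine ⟨ι × ι', inferInstance, fun p => c p.1 * c' p.2, fun p => m p.1 + m' p.2,
    ⟨fun p => mul_nonneg (hc _) (hc' _), fun s => ?_⟩, ?_⟩
  · push_cast
    rw [hK, hK', Finset.sum_mul_sum, Fintype.sum_prod_type]
    refine Finset.sum_congr rfl fun i _ => Finset.sum_congr rfl fun j _ => ?_
    rw [mul_add, add_mul, Complex.exp_add]
    ring
  · refine (mul_le_mul hz hz' hd' (hd.trans hz)).trans ?_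
    unfold zeroCoeff
    rw [Finset.sum_mul_sum, Fintype.sum_prod_type]
    refine Finset.sum_le_sum fun i _ => Finset.sum_le_sum fun j _ => ?_
    have := mul_nonneg (hc i) (hc' j)
    by_cases h1 : m i = 0
    · by_cases h2 : m' j = 0
      · simp [h1, h2]
      · simp [h1, h2]
    · simp only [h1, if_false, zero_mul]
      split_ifs <;> simp [this]

lemma HasNonnegTrigSum.prod {k : ℕ} {K : Fin k → ℝ → ℝ} {d : ℝ} (hd : 0 ≤ d)
    (h : ∀ j, HasNonnegTrigSum (K j) d) : HasNonnegTrigSum (fun s => ∏ j, K j s) (d ^ k) := by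
  induction k with
  | zero => simpa using hasNonnegTrigSum_one
  | succ k ih =>
    simp only [Fin.prod_univ_succ]
    rw [pow_succ']
    exact (h 0).mul (ih fun j => h j.succ) hd (pow_nonneg hd _)

/-- The kernel is `cos (ls / 2) ^ (2n)`. Its binomial expansion has the central coefficient `choose
(2n) n / 4 ^ n`, which decays only polynomially in `n`. -/
lemma hasNonnegTrigSum_cos_pow (l : ℝ) (n : ℕ) :
    HasNonnegTrigSum (fun s => ((1 + Real.cos (l * s)) / 2) ^ n) (1 / (2 * n + 1)) := by
  classical
  refine ⟨Fin (2 * n + 1), inferInstance, fun i => (Nat.choose (2 * n) i : ℝ) / 4 ^ n,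
    fun i => ((i : ℝ) - n) * l, ⟨fun i => by positivity, fun s => ?_⟩, ?_⟩
  · set z : ℂ := Complex.exp (Complex.I * (l * s / 2)) with hz
    have hz0 : z ≠ 0 := Complex.exp_ne_zero _
    have h1 : (((1 + Real.cos (l * s)) / 2 : ℝ) : ℂ) = (z + z⁻¹) ^ 2 / 4 := by
      have h2 : ((Real.cos (l * s) : ℝ) : ℂ) = (z ^ 2 + (z⁻¹) ^ 2) / 2 := by
        push_cast
        rw [Complex.cos, hz, ← Complex.exp_neg, ← Complex.exp_nat_mul, ← Complex.exp_nat_mul]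
        congr 2 <;> (congr 1; push_cast; ring)
      push_cast at h2 ⊢
      rw [h2]
      field_simp
      ring
    rw [Complex.ofReal_pow, h1, div_pow, ← pow_mul, add_pow, Finset.sum_range, Finset.sum_div]
    refine Finset.sum_congr rfl fun i _ => ?_
    have hi : (i : ℕ) ≤ 2 * n := Nat.lt_succ_iff.1 i.2
    have h3 : z ^ (i : ℕ) * z⁻¹ ^ (2 * n - (i : ℕ))
        = Complex.exp (Complex.I * ((((i : ℝ) - n) * l : ℝ) : ℂ) * s) := by
      rw [hz, ← Complex.exp_neg, ← Complex.exp_nat_mul, ← Complex.exp_nat_mul, ← Complex.exp_add]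
      congr 1
      push_cast [Nat.cast_sub hi]
      ring
    rw [h3]
    push_cast
    ring
  · have h1 : (1 : ℝ) / (2 * n + 1) ≤ (Nat.choose (2 * n) n : ℝ) / 4 ^ n := by
      rw [div_le_div_iff₀ (by positivity) (by positivity), one_mul]
      have h2 : 4 ^ n ≤ Nat.choose (2 * n) n * (2 * n + 1) := by
        rcases Nat.eq_zero_or_pos n with rfl | hn
        · simp
        · have h3 := Nat.four_pow_le_two_mul_self_mul_centralBinom n hn
          rw [Nat.centralBinom_eq_two_mul_choose] at h3
          nlinarith
      exact_mod_cast h2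
    refine h1.trans ?_
    have h2 := Finset.single_le_sum (s := Finset.univ)
      (f := fun i : Fin (2 * n + 1) =>
        if ((i : ℝ) - n) * l = 0 then (Nat.choose (2 * n) i : ℝ) / 4 ^ n else 0)
      (fun i _ => by split_ifs <;> positivity)
      (Finset.mem_univ (⟨n, by omega⟩ : Fin (2 * n + 1)))
    unfold zeroCoeff
    simpa using h2

lemma exists_norm_integral_exp_sub_le (m : ℝ) [Decidable (m = 0)] :
    ∃ B : ℝ, ∀ T t : ℝ, ‖(∫ u in (0 : ℝ)..T, Complex.exp (Complex.I * (m : ℂ) * ((u - t : ℝ) : ℂ)))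
      - (if m = 0 then (T : ℂ) else 0)‖ ≤ B := by
  by_cases hm : m = 0
  · exact ⟨0, fun T t => by simp [hm]⟩
  · refine ⟨2 / |m|, fun T t => ?_⟩
    have hc : Complex.I * (m : ℂ) ≠ 0 := mul_ne_zero Complex.I_ne_zero (by exact_mod_cast hm)
    have h1 : ∀ u : ℝ, Complex.exp (Complex.I * (m : ℂ) * ((u - t : ℝ) : ℂ))
        = Complex.exp (Complex.I * (m : ℂ) * ((-t : ℝ) : ℂ))
          * Complex.exp (Complex.I * (m : ℂ) * (u : ℂ)) := by
      intro u
      rw [← Complex.exp_add]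
      push_cast
      ring_nf
    have hn : ∀ u : ℝ, ‖Complex.exp (Complex.I * (m : ℂ) * (u : ℂ))‖ = 1 := by
      intro u
      rw [mul_assoc, mul_comm, ← Complex.ofReal_mul]
      exact Complex.norm_exp_ofReal_mul_I _
    simp_rw [h1]
    rw [intervalIntegral.integral_const_mul, integral_exp_mul_complex hc, if_neg hm, sub_zero,
      norm_mul, hn, one_mul, norm_div, norm_mul, Complex.norm_I, one_mul, Complex.norm_real,
      Real.norm_eq_abs]
    refine div_le_div_of_nonneg_right ?_ (abs_nonneg m)
    refine (norm_sub_le _ _).trans ?_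
    rw [hn, hn]
    norm_num

lemma continuous_exp_mul_ofReal (m t : ℝ) :
    Continuous fun u : ℝ => Complex.exp (Complex.I * (m : ℂ) * ((u - t : ℝ) : ℂ)) := by
  fun_prop

/-- The integral means of a trigonometric polynomial converge to its zeroth coefficient, uniformly
in the translation. -/
lemma IsNonnegTrigSum.exists_abs_integral_sub_le {ι : Type} [Fintype ι] {K : ℝ → ℝ} {c m : ι → ℝ}
    (h : IsNonnegTrigSum K c m) :
    ∃ B : ℝ, 0 ≤ B ∧ ∀ T t : ℝ, |(∫ u in (0 : ℝ)..T, K (u - t)) - T * zeroCoeff c m| ≤ B := by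
  classical
  obtain ⟨hc, hK⟩ := h
  choose B hB using fun i => exists_norm_integral_exp_sub_le (m i)
  have hB0 : ∀ i, 0 ≤ B i := fun i => (norm_nonneg _).trans (hB i 0 0)
  refine ⟨∑ i, c i * B i, Finset.sum_nonneg fun i _ => mul_nonneg (hc i) (hB0 i), fun T t => ?_⟩
  have h1 : (((∫ u in (0 : ℝ)..T, K (u - t)) - T * zeroCoeff c m : ℝ) : ℂ)
      = ∑ i, (c i : ℂ) * ((∫ u in (0 : ℝ)..T,
          Complex.exp (Complex.I * (m i : ℂ) * ((u - t : ℝ) : ℂ)))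
            - (if m i = 0 then (T : ℂ) else 0)) := by
    rw [Complex.ofReal_sub, ← intervalIntegral.integral_ofReal]
    simp_rw [hK]
    rw [intervalIntegral.integral_finsetSum fun i _ =>
      ((continuous_exp_mul_ofReal (m i) t).const_mul _).intervalIntegrable _ _]
    simp_rw [intervalIntegral.integral_const_mul]
    simp_rw [mul_sub, Finset.sum_sub_distrib]
    congr 1
    unfold zeroCoeff
    push_cast
    rw [Finset.mul_sum]
    refine Finset.sum_congr rfl fun i _ => ?_
    split_ifs <;> simp [mul_comm]
  rw [← Real.norm_eq_abs, ← Complex.norm_real, h1]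
  refine (norm_sum_le _ _).trans (Finset.sum_le_sum fun i _ => ?_)
  rw [norm_mul, Complex.norm_real, Real.norm_eq_abs, abs_of_nonneg (hc i)]
  exact mul_le_mul_of_nonneg_left (hB i T t) (hc i)

/-! ### Uniform approximation by trigonometric polynomials. -/

section Approximation

variable {I : AddSubmonoid ℝ} {X : Type*} [NormedAddCommGroup X] [NormedSpace ℂ X]

/-- The function `t ↦ e^{irt} x`. -/
noncomputable def expFun (I : AddSubmonoid ℝ) (r : ℝ) (x : X) : C(I, X) where
  toFun t := Complex.exp (Complex.I * (r : ℂ) * ((t : ℝ) : ℂ)) • x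
  continuous_toFun := by fun_prop

lemma expFun_apply (r : ℝ) (x : X) (t : I) :
    expFun I r x t = Complex.exp (Complex.I * (r : ℂ) * ((t : ℝ) : ℂ)) • x := rfl

/-- The space of trigonometric polynomials. -/
def trigPoly (I : AddSubmonoid ℝ) (X : Type*) [NormedAddCommGroup X] [NormedSpace ℂ X] :
    Submodule ℂ C(I, X) :=
  Submodule.span ℂ {p | ∃ (r : ℝ) (x : X), p = expFun I r x}

/-- The mean `(1 / T) ∫_0^T K (u - t) F u du` of a function against a trigonometric polynomial
kernel is a trigonometric polynomial in `t`. -/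
lemma IsNonnegTrigSum.exists_trigPoly {ι : Type} [Fintype ι] {K : ℝ → ℝ} {c m : ι → ℝ}
    (h : IsNonnegTrigSum K c m) {F : ℝ → X} (hF : Continuous F) (T : ℝ) :
    ∃ p ∈ trigPoly I X, ∀ t : I, p t = ∫ u in (0 : ℝ)..T, (K (u - t) : ℂ) • F u := by
  refine ⟨∑ i, (c i : ℂ) • expFun I (-m i)
    (∫ u in (0 : ℝ)..T, Complex.exp (Complex.I * (m i : ℂ) * (u : ℂ)) • F u),
    Submodule.sum_mem _ fun i _ => Submodule.smul_mem _ _ (Submodule.subset_span ⟨_, _, rfl⟩),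
    fun t => ?_⟩
  simp_rw [h.2, Finset.sum_smul]
  have hi : ∀ i ∈ Finset.univ, IntervalIntegrable
      (fun u : ℝ => ((c i : ℂ) * Complex.exp (Complex.I * (m i : ℂ) * ((u - t : ℝ) : ℂ))) • F u)
      MeasureTheory.volume 0 T := fun i _ => Continuous.intervalIntegrable (by fun_prop) _ _
  rw [intervalIntegral.integral_finsetSum hi]
  rw [ContinuousMap.sum_apply]
  refine Finset.sum_congr rfl fun i _ => ?_
  rw [ContinuousMap.smul_apply, expFun_apply, ← intervalIntegral.integral_smul,
    ← intervalIntegral.integral_smul]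
  refine intervalIntegral.integral_congr fun u _ => ?_
  simp only [smul_smul]
  rw [mul_assoc, ← Complex.exp_add]
  congr 3
  push_cast
  ring_nf

/-- The approximation theorem: an almost periodic function is a uniform limit of trigonometric
polynomials. -/
theorem AlmostAnti.IsAlmostPeriodic.exists_trigPoly_norm_sub_le [CompleteSpace X]
    (hI : I = ⊤ ∨ I = AddSubmonoid.nonneg ℝ) {f : C(I, X)} (hf : AlmostAnti.IsAlmostPeriodic f)
    {ε : ℝ} (hε : 0 < ε) : ∃ p ∈ trigPoly I X, ∀ t, ‖f t - p t‖ ≤ ε := by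
  obtain ⟨M, hM0, hM⟩ := hf.exists_norm_le hI
  obtain ⟨k, l, hl⟩ := hf.exists_bohr_isTranslationBound hI (show 0 < ε / 4 by linarith)
  set q : ℝ := (1 + √2 / 2) / 2 with hq
  have hs2 : √2 < 2 := by
    rw [Real.sqrt_lt' (by norm_num)]
    norm_num
  have hq0 : 0 ≤ q := by positivity
  have hq1 : q < 1 := by rw [hq]; linarith
  -- Off the Bohr set the kernel is at most `q ^ n`, while its mean is at least `(2n + 1) ^ (-k)`:
  -- exponential decay wins.
  obtain ⟨n, hn⟩ : ∃ n : ℕ, 2 * M * (q ^ n * (2 * n + 1) ^ k) ≤ ε / 4 := by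
    have h1 : Tendsto (fun n : ℕ => 2 * M * (q ^ n * (2 * n + 1) ^ k)) atTop (𝓝 0) := by
      have h2 : Tendsto (fun n : ℕ => 2 * M * 3 ^ k * ((n : ℝ) ^ k * q ^ n)) atTop (𝓝 0) := by
        have := tendsto_pow_const_mul_const_pow_of_abs_lt_one k
          (show |q| < 1 by rwa [abs_of_nonneg hq0])
        simpa using this.const_mul (2 * M * 3 ^ k)
      refine squeeze_zero' (Eventually.of_forall fun n => by positivity) ?_ h2
      filter_upwards [eventually_ge_atTop 1] with n hn
      have hn' : (1 : ℝ) ≤ n := by exact_mod_cast hn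
      have h3 : (2 * (n : ℝ) + 1) ^ k ≤ (3 * n) ^ k :=
        pow_le_pow_left₀ (by positivity) (by linarith) k
      rw [mul_pow] at h3
      calc 2 * M * (q ^ n * (2 * n + 1) ^ k) ≤ 2 * M * (q ^ n * (3 ^ k * n ^ k)) := by gcongr
        _ = _ := by ring
    exact ((h1.eventually (ge_mem_nhds (show (0 : ℝ) < ε / 4 by linarith))).exists)
  set K : ℝ → ℝ := fun s => ∏ j, ((1 + Real.cos (l j * s)) / 2) ^ n with hKdef
  have hd : (0 : ℝ) < 1 / (2 * n + 1) := by positivity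
  obtain ⟨ι, _, c, m, hK, hz⟩ := HasNonnegTrigSum.prod hd.le fun j =>
    hasNonnegTrigSum_cos_pow (l j) n
  change IsNonnegTrigSum K c m at hK
  set c₀ := zeroCoeff c m with hc₀
  have hc0 : 0 < c₀ := lt_of_lt_of_le (by positivity) hz
  have hn' : 2 * M * q ^ n ≤ ε / 4 * c₀ := by
    have h1 : (1 / (2 * n + 1 : ℝ)) ^ k * (2 * n + 1) ^ k = 1 := by
      rw [← mul_pow, one_div_mul_cancel (by positivity), one_pow]
    calc 2 * M * q ^ n = 2 * M * (q ^ n * (2 * n + 1) ^ k) * (1 / (2 * n + 1 : ℝ)) ^ k := by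
          linear_combination (-(2 * M * q ^ n)) * h1
      _ ≤ ε / 4 * (1 / (2 * n + 1 : ℝ)) ^ k := by gcongr
      _ ≤ ε / 4 * c₀ := by gcongr
  have hfac0 : ∀ x : ℝ, 0 ≤ (1 + Real.cos x) / 2 := fun x => by linarith [Real.neg_one_le_cos x]
  have hfac1 : ∀ x : ℝ, (1 + Real.cos x) / 2 ≤ 1 := fun x => by linarith [Real.cos_le_one x]
  have hK0 : ∀ s, 0 ≤ K s := fun s => Finset.prod_nonneg fun j _ => pow_nonneg (hfac0 _) _
  have hKc : Continuous K := by
    simp only [hKdef]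
    fun_prop
  have hKq : ∀ s, ¬ IsTranslationBound f (ε / 4) s → K s ≤ q ^ n := by
    intro s hs
    have h1 : ∃ j, Real.cos (l j * s) ≤ √2 / 2 := by
      by_contra! hcon
      exact hs (hl s hcon)
    obtain ⟨j, hj⟩ := h1
    simp only [hKdef]
    rw [← Finset.mul_prod_erase Finset.univ _ (Finset.mem_univ j)]
    have h2 : ((1 + Real.cos (l j * s)) / 2) ^ n ≤ q ^ n :=
      pow_le_pow_left₀ (hfac0 _) (by rw [hq]; linarith) n
    have h3 : ∏ i ∈ Finset.univ.erase j, ((1 + Real.cos (l i * s)) / 2) ^ n ≤ 1 :=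
      Finset.prod_le_one (fun i _ => pow_nonneg (hfac0 _) _)
        fun i _ => pow_le_one₀ (hfac0 _) (hfac1 _)
    have h4 := pow_nonneg (hfac0 (l j * s)) n
    exact (mul_le_of_le_one_right h4 h3).trans h2
  obtain ⟨B, hB0, hB⟩ := hK.exists_abs_integral_sub_le
  set F := halfLineExt hI f with hFdef
  have hFc : Continuous F := continuous_halfLineExt hI f
  -- The error `B` in the kernel's integral does not depend on `t`, so one finite `T` serves all
  -- `t`.
  set T : ℝ := (B * (ε / 4) + B * M) / (ε / 4 * c₀) + 1 with hT
  have hT0 : 0 < T := by positivity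
  have hTB : B * (ε / 4) + B * M ≤ ε / 4 * (c₀ * T) := by
    have : B * (ε / 4) + B * M = ε / 4 * c₀ * ((B * (ε / 4) + B * M) / (ε / 4 * c₀)) := by
      field_simp
    rw [this, ← mul_assoc]
    gcongr
    rw [hT]
    linarith
  obtain ⟨p, hp, hpt⟩ := hK.exists_trigPoly (I := I) hFc T
  refine ⟨((1 / (c₀ * T) : ℝ) : ℂ) • p, Submodule.smul_mem _ _ hp, fun t => ?_⟩
  have hcT : 0 < c₀ * T := by positivity
  have hKt : Continuous fun u => K (u - t) := by fun_prop
  have hpt' : ‖p t - ((c₀ * T : ℝ) : ℂ) • f t‖ ≤ ε * (c₀ * T) := by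
    -- The first term is small because `K` is small wherever `u - t` is not an almost period; the
    -- second is the normalization error. Together they stay below `3 / 4` of the allowed bound.
    have h1 : p t - ((c₀ * T : ℝ) : ℂ) • f t
        = (∫ u in (0 : ℝ)..T, (K (u - t) : ℂ) • (F u - f t))
          + (((∫ u in (0 : ℝ)..T, K (u - t)) - T * c₀ : ℝ) : ℂ) • f t := by
      have hKtc : Continuous fun u => (K (u - t) : ℂ) := Complex.continuous_ofReal.comp hKt
      rw [hpt]
      simp_rw [smul_sub]
      have hi1 : IntervalIntegrable (fun u : ℝ => (K (u - t) : ℂ) • F u) MeasureTheory.volume 0 T :=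
        Continuous.intervalIntegrable (by fun_prop) _ _
      have hi2 : IntervalIntegrable (fun u : ℝ => (K (u - t) : ℂ) • f t)
          MeasureTheory.volume 0 T :=
        Continuous.intervalIntegrable (by fun_prop) _ _
      rw [intervalIntegral.integral_sub hi1 hi2, intervalIntegral.integral_smul_const,
        intervalIntegral.integral_ofReal, Complex.ofReal_sub, sub_smul, mul_comm T]
      abel
    have h2 : ‖∫ u in (0 : ℝ)..T, (K (u - t) : ℂ) • (F u - f t)‖
        ≤ ∫ u in (0 : ℝ)..T, (K (u - t) * (ε / 4) + q ^ n * (2 * M)) := by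
      refine intervalIntegral.norm_integral_le_of_norm_le hT0.le ?_
        (((hKt.mul continuous_const).add continuous_const).intervalIntegrable _ _)
      refine Eventually.of_forall fun u hu => ?_
      have hu0 : 0 ≤ u := hu.1.le
      rw [norm_smul, Complex.norm_real, Real.norm_eq_abs, abs_of_nonneg (hK0 _)]
      have hFu : F u = f ⟨u, mem_of_nonneg_of_domain hI hu0⟩ :=
        halfLineExt_coe hI f (t := ⟨u, mem_of_nonneg_of_domain hI hu0⟩) hu0
      rw [hFu]
      have hq' : 0 ≤ q ^ n * (2 * M) := by positivity
      by_cases hb : IsTranslationBound f (ε / 4) (u - t)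
      · have := mul_le_mul_of_nonneg_left
          (hb t ⟨u, mem_of_nonneg_of_domain hI hu0⟩ (by simp)) (hK0 (u - t))
        linarith
      · have h3 : ‖f ⟨u, mem_of_nonneg_of_domain hI hu0⟩ - f t‖ ≤ 2 * M := by
          refine (norm_sub_le _ _).trans ?_
          linarith [hM ⟨u, mem_of_nonneg_of_domain hI hu0⟩, hM t]
        have h4 := mul_le_mul (hKq _ hb) h3 (norm_nonneg _) (by positivity)
        have h5 := mul_nonneg (hK0 (u - t)) hε.le
        linarith
    have h3 : ∫ u in (0 : ℝ)..T, (K (u - t) * (ε / 4) + q ^ n * (2 * M))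
        = (∫ u in (0 : ℝ)..T, K (u - t)) * (ε / 4) + T * (q ^ n * (2 * M)) := by
      have hi1 : IntervalIntegrable (fun u : ℝ => K (u - t) * (ε / 4)) MeasureTheory.volume 0 T :=
        Continuous.intervalIntegrable (by fun_prop) _ _
      rw [intervalIntegral.integral_add hi1 (continuous_const.intervalIntegrable _ _), intervalIntegral.integral_mul_const,
        intervalIntegral.integral_const, sub_zero, smul_eq_mul]
    have h4 := hB T t
    have h5 : ‖(((∫ u in (0 : ℝ)..T, K (u - t)) - T * c₀ : ℝ) : ℂ) • f t‖ ≤ B * M := by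
      rw [norm_smul, Complex.norm_real, Real.norm_eq_abs]
      exact mul_le_mul h4 (hM t) (norm_nonneg _) hB0
    rw [h1]
    refine (norm_add_le _ _).trans ?_
    rw [h3] at h2
    have h6 := (abs_le.1 h4).2
    have h7 : (∫ u in (0 : ℝ)..T, K (u - t)) * (ε / 4) ≤ (T * c₀ + B) * (ε / 4) := by
      gcongr
      linarith
    have h8 := mul_le_mul_of_nonneg_left hn' hT0.le
    have h9 : 0 < ε * (c₀ * T) := by positivity
    linarith
  have h1 : f t - (((1 / (c₀ * T) : ℝ) : ℂ) • p) t
      = ((-(1 / (c₀ * T)) : ℝ) : ℂ) • (p t - ((c₀ * T : ℝ) : ℂ) • f t) := by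
    rw [smul_sub, smul_smul, ← Complex.ofReal_mul, ContinuousMap.smul_apply, neg_mul,
      one_div_mul_cancel hcT.ne']
    push_cast
    module
  rw [h1, norm_smul, Complex.norm_real, Real.norm_eq_abs, abs_neg, abs_of_pos (by positivity),
    one_div_mul_eq_div, div_le_iff₀ hcT]
  exact hpt'

end Approximation

/-! ### Mean values. -/

section Mean

variable {I : AddSubmonoid ℝ} {X : Type*} [NormedAddCommGroup X] [NormedSpace ℂ X]

/-- The mean value of `f` over `[0, T]`. -/
noncomputable def meanOn (hI : I = ⊤ ∨ I = AddSubmonoid.nonneg ℝ) (f : C(I, X)) (T : ℝ) : X :=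
  (1 / T) • ∫ s in (0 : ℝ)..T, halfLineExt hI f s

lemma hasBohrTransform_zero_iff (hI : I = ⊤ ∨ I = AddSubmonoid.nonneg ℝ) (f : C(I, X)) (x : X) :
    AlmostAnti.HasBohrTransform f 0 x ↔ Tendsto (meanOn hI f) atTop (𝓝 x) := by
  unfold AlmostAnti.HasBohrTransform
  refine tendsto_congr' ?_
  filter_upwards [eventually_ge_atTop 0] with T hT
  unfold meanOn
  congr 1
  refine intervalIntegral.integral_congr fun s hs => ?_
  rw [Set.uIcc_of_le hT] at hs
  have h1 := Subtype.val_injective.extend_apply (fun u : I => f u) (0 : ℝ → X)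
    ⟨s, mem_of_nonneg_of_domain hI hs.1⟩
  have h2 := halfLineExt_coe hI f (t := ⟨s, mem_of_nonneg_of_domain hI hs.1⟩) hs.1
  simp only [Complex.ofReal_zero, mul_zero, zero_mul, neg_zero, Complex.exp_zero, one_smul]
  exact h1.trans h2.symm

lemma meanOn_add (hI : I = ⊤ ∨ I = AddSubmonoid.nonneg ℝ) (f g : C(I, X)) (T : ℝ) :
    meanOn hI (f + g) T = meanOn hI f T + meanOn hI g T := by
  unfold meanOn
  rw [← smul_add, ← intervalIntegral.integral_add (intervalIntegrable_halfLineExt hI f _ _)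
    (intervalIntegrable_halfLineExt hI g _ _)]
  rfl

lemma meanOn_smul (hI : I = ⊤ ∨ I = AddSubmonoid.nonneg ℝ) (c : ℂ) (f : C(I, X)) (T : ℝ) :
    meanOn hI (c • f) T = c • meanOn hI f T := by
  unfold meanOn
  rw [smul_comm c, ← intervalIntegral.integral_smul c]
  rfl

/-- With `x = 0` this is the continuity of the mean; with general `x` it isolates the constant term
of an approximant. -/
lemma norm_meanOn_sub_sub_le [CompleteSpace X] (hI : I = ⊤ ∨ I = AddSubmonoid.nonneg ℝ)
    {f g : C(I, X)} {x : X} {ε : ℝ} (h : ∀ t, ‖f t - g t - x‖ ≤ ε) {T : ℝ} (hT : 0 < T) :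
    ‖meanOn hI f T - meanOn hI g T - x‖ ≤ ε := by
  have h1 : meanOn hI f T - meanOn hI g T - x = (1 / T) • ∫ s in (0 : ℝ)..T,
      (halfLineExt hI f s - halfLineExt hI g s - x) := by
    rw [intervalIntegral.integral_sub ((intervalIntegrable_halfLineExt hI f _ _).sub
      (intervalIntegrable_halfLineExt hI g _ _)) (continuous_const.intervalIntegrable _ _),
      intervalIntegral.integral_sub (intervalIntegrable_halfLineExt hI f _ _)
      (intervalIntegrable_halfLineExt hI g _ _), intervalIntegral.integral_const, smul_sub,
      smul_sub, sub_zero, smul_smul, one_div_mul_cancel hT.ne', one_smul]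
    rfl
  have h2 : ‖∫ s in (0 : ℝ)..T, (halfLineExt hI f s - halfLineExt hI g s - x)‖ ≤ ε * |T - 0| :=
    intervalIntegral.norm_integral_le_of_norm_le_const fun s _ => h _
  rw [h1, norm_smul, Real.norm_eq_abs, abs_of_pos (by positivity), one_div_mul_eq_div,
    div_le_iff₀ hT]
  rwa [sub_zero, abs_of_pos hT] at h2

end Mean

/-! ### Almost anti-periodic functions and exponentials. -/

section AntiPeriodic

variable {I : AddSubmonoid ℝ} {X : Type*} [NormedAddCommGroup X]

/-- Twice an `ε / 2`-antiperiod is an `ε`-period; doubling an antiperiod from `[a / 2, a / 2 + l]`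
puts it in `[a, a + 2l]`. -/
lemma AlmostAnti.IsAlmostAntiPeriodic.isAlmostPeriodic
    (hI : I = ⊤ ∨ I = AddSubmonoid.nonneg ℝ) {g : C(I, X)}
    (hg : AlmostAnti.IsAlmostAntiPeriodic g) : AlmostAnti.IsAlmostPeriodic g := by
  intro ε hε
  obtain ⟨l, hl, h⟩ := hg (ε / 2) (by linarith)
  refine ⟨2 * l, by linarith, fun a => ?_⟩
  have ha : (a : ℝ) / 2 ∈ I := by
    rcases hI with rfl | rfl
    · trivial
    · have := a.2
      rw [AddSubmonoid.mem_nonneg] at *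
      linarith
  obtain ⟨τ, ⟨hτ0, hτ⟩, h1, h2⟩ := h ⟨_, ha⟩
  simp only at h1 h2
  refine ⟨τ + τ, ⟨fun h0 => hτ0 (Subtype.ext ?_), fun t => ?_⟩, ?_, ?_⟩
  · have := congrArg Subtype.val h0
    simp only [AddSubmonoid.coe_add, ZeroMemClass.coe_zero] at this ⊢
    linarith
  · have h3 := hτ t
    have h4 := hτ (t + τ)
    rw [← add_assoc]
    have h5 := norm_sub_le (g (t + τ + τ) + g (t + τ)) (g (t + τ) + g t)
    have h6 : g (t + τ + τ) + g (t + τ) - (g (t + τ) + g t) = g (t + τ + τ) - g t := by abel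
    rw [h6] at h5
    linarith
  · simp only [AddSubmonoid.coe_add]
    linarith
  · simp only [AddSubmonoid.coe_add]
    linarith

/-- An almost anti-periodic function has mean value zero. -/
lemma AlmostAnti.IsAlmostAntiPeriodic.tendsto_meanOn [NormedSpace ℂ X]
    (hI : I = ⊤ ∨ I = AddSubmonoid.nonneg ℝ) {g : C(I, X)}
    (hg : AlmostAnti.IsAlmostAntiPeriodic g) : Tendsto (meanOn hI g) atTop (𝓝 0) := by
  obtain ⟨M, hM0, hM⟩ := (hg.isAlmostPeriodic hI).exists_norm_le hI
  rw [Metric.tendsto_atTop]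
  intro ε hε
  obtain ⟨l, hl, h⟩ := hg ε hε
  -- Starting the interval at `1` makes `τ` positive on the full line as well.
  obtain ⟨τ, ⟨hτ0, hτ⟩, h1, h2⟩ := h ⟨1, mem_of_nonneg_of_domain hI zero_le_one⟩
  simp only at h1
  have hτpos : 0 < (τ : ℝ) := by linarith
  refine ⟨2 * M * τ / ε + 1, fun T hT => ?_⟩
  have hT0 : 0 < T := lt_of_lt_of_le (by positivity) hT
  have hTε : 2 * M * τ < ε * T := by
    have : 2 * M * τ / ε < T := by linarith
    rwa [div_lt_iff₀' hε] at this
  set F := halfLineExt hI g with hF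
  have hint : ∀ a b, IntervalIntegrable F MeasureTheory.volume a b :=
    intervalIntegrable_halfLineExt hI g
  have hFM : ∀ s, ‖F s‖ ≤ M := fun s => hM _
  have h3 : ‖∫ s in (0 : ℝ)..T, (F (s + τ) + F s)‖ ≤ ε * |T - 0| := by
    refine intervalIntegral.norm_integral_le_of_norm_le_const fun s hs => ?_
    rw [Set.uIoc_of_le hT0.le] at hs
    have hs0 : 0 ≤ s := hs.1.le
    have h4 := halfLineExt_coe hI g (t := ⟨s, mem_of_nonneg_of_domain hI hs0⟩) hs0
    have h5 := halfLineExt_coe hI g (t := ⟨s, mem_of_nonneg_of_domain hI hs0⟩ + τ)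
      (by simp only [AddSubmonoid.coe_add]; linarith)
    simp only [AddSubmonoid.coe_add] at h4 h5
    rw [hF, h4, h5]
    exact hτ _
  have h4 : ‖∫ s in T..(T + τ), F s‖ ≤ M * |T + τ - T| :=
    intervalIntegral.norm_integral_le_of_norm_le_const fun s _ => hFM s
  have h5 : ‖∫ s in (0 : ℝ)..τ, F s‖ ≤ M * |(τ : ℝ) - 0| :=
    intervalIntegral.norm_integral_le_of_norm_le_const fun s _ => hFM s
  rw [sub_zero, abs_of_pos hT0] at h3
  rw [add_sub_cancel_left, abs_of_pos hτpos] at h4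
  rw [sub_zero, abs_of_pos hτpos] at h5
  have h6 : (2 : ℝ) • ∫ s in (0 : ℝ)..T, F s = (∫ s in (0 : ℝ)..T, (F (s + τ) + F s))
      - (∫ s in T..(T + τ), F s) + ∫ s in (0 : ℝ)..τ, F s := by
    have hsh : IntervalIntegrable (fun s => F (s + τ)) MeasureTheory.volume 0 T :=
      ((continuous_halfLineExt hI g).comp (continuous_id.add continuous_const)).intervalIntegrable
        _ _
    rw [intervalIntegral.integral_add hsh (hint _ _),
      intervalIntegral.integral_comp_add_right F, zero_add,
      ← intervalIntegral.integral_interval_sub_left (hint 0 (T + τ)) (hint 0 τ),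
      ← intervalIntegral.integral_interval_sub_left (hint 0 (T + τ)) (hint 0 T), two_smul]
    abel
  have h7 : 2 * ‖∫ s in (0 : ℝ)..T, F s‖ ≤ ε * T + 2 * M * τ := by
    have h8 := congrArg norm h6
    rw [norm_smul, Real.norm_two] at h8
    rw [h8]
    refine (norm_add_le _ _).trans ?_
    have := norm_sub_le (∫ s in (0 : ℝ)..T, (F (s + τ) + F s)) (∫ s in T..(T + τ), F s)
    linarith
  rw [dist_zero_right, meanOn, norm_smul, Real.norm_eq_abs, abs_of_pos (by positivity),
    one_div_mul_eq_div, div_lt_iff₀ hT0]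
  linarith

lemma exp_odd_mul_pi (k : ℤ) :
    Complex.exp (Complex.I * (((2 * k + 1) * Real.pi : ℝ) : ℂ)) = -1 := by
  have : Complex.I * (((2 * k + 1) * Real.pi : ℝ) : ℂ)
      = (k : ℂ) * (2 * Real.pi * Complex.I) + Real.pi * Complex.I := by
    push_cast
    ring
  rw [this, Complex.exp_add, Complex.exp_int_mul_two_pi_mul_I, Complex.exp_pi_mul_I, one_mul]

lemma exp_odd_mul_pi_div_abs {r : ℝ} (hr : r ≠ 0) (k : ℤ) :
    Complex.exp (Complex.I * ((r * ((2 * k + 1) * Real.pi / |r|) : ℝ) : ℂ)) = -1 := by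
  rcases lt_or_gt_of_ne hr with h | h
  · rw [← exp_odd_mul_pi (-k - 1), abs_of_neg h]
    congr 3
    push_cast
    field_simp
    ring
  · rw [← exp_odd_mul_pi k, abs_of_pos h]
    congr 3
    field_simp

/-- The odd multiples of `π / |r|` are exact antiperiods, spaced `2π / |r|` apart. -/
lemma isAlmostAntiPeriodic_expFun [NormedSpace ℂ X]
    (hI : I = ⊤ ∨ I = AddSubmonoid.nonneg ℝ) {r : ℝ} (hr : r ≠ 0) (x : X) :
    AlmostAnti.IsAlmostAntiPeriodic (expFun I r x) := by
  intro ε hε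
  have hr0 : 0 < |r| := abs_pos.2 hr
  have hpi := Real.pi_pos
  refine ⟨2 * Real.pi / |r|, by positivity, fun a => ?_⟩
  set k : ℤ := ⌈(a : ℝ) * |r| / (2 * Real.pi) - 1 / 2⌉ with hk
  have h1 := Int.le_ceil ((a : ℝ) * |r| / (2 * Real.pi) - 1 / 2)
  have h2 := Int.ceil_lt_add_one ((a : ℝ) * |r| / (2 * Real.pi) - 1 / 2)
  rw [← hk] at h1 h2
  have h3 : (a : ℝ) ≤ (2 * k + 1) * Real.pi / |r| := by
    rw [le_div_iff₀ hr0]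
    have : (a : ℝ) * |r| / (2 * Real.pi) ≤ k + 1 / 2 := by linarith
    rw [div_le_iff₀ (by positivity)] at this
    linarith
  have h4 : (2 * k + 1) * Real.pi / |r| ≤ (a : ℝ) + 2 * Real.pi / |r| := by
    rw [← sub_le_iff_le_add, ← sub_div, div_le_iff₀ hr0]
    have : (k : ℝ) - 1 / 2 ≤ (a : ℝ) * |r| / (2 * Real.pi) := by linarith
    rw [le_div_iff₀ (by positivity)] at this
    linarith
  have hmem : (2 * k + 1) * Real.pi / |r| ∈ I := by
    rcases hI with rfl | rfl
    · trivial
    · have := a.2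
      rw [AddSubmonoid.mem_nonneg] at *
      exact this.trans h3
  refine ⟨⟨_, hmem⟩, ⟨fun h0 => ?_, fun t => ?_⟩, h3, h4⟩
  · have h5 := congrArg Subtype.val h0
    simp only [ZeroMemClass.coe_zero, div_eq_zero_iff, mul_eq_zero, hpi.ne', hr0.ne',
      or_false] at h5
    have h6 : 2 * k + 1 = 0 := by exact_mod_cast h5
    omega
  · rw [expFun_apply, expFun_apply]
    have h5 : Complex.I * (r : ℂ)
        * (((t + ⟨(2 * k + 1) * Real.pi / |r|, hmem⟩ : I) : ℝ) : ℂ)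
        = Complex.I * ((r * ((2 * k + 1) * Real.pi / |r|) : ℝ) : ℂ)
          + Complex.I * (r : ℂ) * ((t : ℝ) : ℂ) := by
      simp only [AddSubmonoid.coe_add, Complex.ofReal_add, Complex.ofReal_mul r]
      ring
    rw [h5, Complex.exp_add, exp_odd_mul_pi_div_abs hr]
    simpa using hε.le

/-- A trigonometric polynomial is the sum of a constant and of a linear combination of almost
anti-periodic functions. -/
lemma exists_mem_ANP₀_add_const [NormedSpace ℂ X] (hI : I = ⊤ ∨ I = AddSubmonoid.nonneg ℝ)
    {p : C(I, X)} (hp : p ∈ trigPoly I X) :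
    ∃ g ∈ AlmostAnti.ANP₀ I X, ∃ x : X, ∀ t, p t = g t + x := by
  induction hp using Submodule.span_induction with
  | mem p hp =>
    obtain ⟨r, x, rfl⟩ := hp
    by_cases hr : r = 0
    · exact ⟨0, Submodule.zero_mem _, x, fun t => by simp [expFun_apply, hr]⟩
    · exact ⟨_, Submodule.subset_span (isAlmostAntiPeriodic_expFun hI hr x), 0, fun t => by simp⟩
  | zero => exact ⟨0, Submodule.zero_mem _, 0, fun t => by simp⟩
  | add p q _ _ hp hq =>
    obtain ⟨g, hg, x, h⟩ := hp
    obtain ⟨g', hg', x', h'⟩ := hq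
    refine ⟨g + g', Submodule.add_mem _ hg hg', x + x', fun t => ?_⟩
    rw [ContinuousMap.add_apply, ContinuousMap.add_apply, h, h']
    abel
  | smul c p _ hp =>
    obtain ⟨g, hg, x, h⟩ := hp
    refine ⟨c • g, Submodule.smul_mem _ c hg, c • x, fun t => ?_⟩
    rw [ContinuousMap.smul_apply, ContinuousMap.smul_apply, h, smul_add]

lemma tendsto_meanOn_of_mem_ANP₀ [NormedSpace ℂ X] (hI : I = ⊤ ∨ I = AddSubmonoid.nonneg ℝ)
    {g : C(I, X)} (hg : g ∈ AlmostAnti.ANP₀ I X) : Tendsto (meanOn hI g) atTop (𝓝 0) := by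
  induction hg using Submodule.span_induction with
  | mem g hg => exact AlmostAnti.IsAlmostAntiPeriodic.tendsto_meanOn hI hg
  | zero =>
    have : meanOn hI (0 : C(I, X)) = fun _ => 0 := by
      funext T
      simpa using meanOn_smul hI 0 (0 : C(I, X)) T
    rw [this]
    exact tendsto_const_nhds
  | add f g _ _ hf hg =>
    rw [funext (meanOn_add hI f g)]
    simpa using hf.add hg
  | smul c f _ hf =>
    rw [funext (meanOn_smul hI c f)]
    simpa using hf.const_smul c

end AntiPeriodic

/-! ### The characterization by mean value. -/

theorem theorem2p5 (I : AddSubmonoid ℝ) (hI : I = ⊤ ∨ I = AddSubmonoid.nonneg ℝ)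
    (X : Type*) [NormedAddCommGroup X] [NormedSpace ℂ X] [CompleteSpace X] :
    AlmostAnti.ANP I X = AlmostAnti.APSpec I X {r : ℝ | r ≠ 0} := by
  ext f
  have hspec : AlmostAnti.bohrSpectrum f ⊆ {r : ℝ | r ≠ 0} ↔
      Tendsto (meanOn hI f) atTop (𝓝 0) := by
    rw [← hasBohrTransform_zero_iff hI f 0]
    constructor
    · intro h
      by_contra hcon
      exact h hcon rfl
    · rintro h r hr rfl
      exact hr h
  refine and_congr_right fun hf => ?_
  rw [hspec]
  constructor
  · intro h
    rw [Metric.tendsto_nhds]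
    intro ε hε
    obtain ⟨g, hg, hfg⟩ := h (ε / 2) (by linarith)
    have hmean := Metric.tendsto_nhds.1 (tendsto_meanOn_of_mem_ANP₀ hI hg) (ε / 2) (by linarith)
    filter_upwards [hmean, eventually_gt_atTop 0] with T h1 hT
    rw [dist_zero_right] at h1 ⊢
    have h2 := norm_meanOn_sub_sub_le hI (f := f) (g := g) (x := 0) (ε := ε / 2)
      (by simpa using hfg) hT
    rw [sub_zero] at h2
    have := norm_le_norm_add_norm_sub (meanOn hI g T) (meanOn hI f T)
    rw [norm_sub_rev] at this
    linarith
  · intro h ε hε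
    obtain ⟨p, hp, hfp⟩ := AlmostAnti.IsAlmostPeriodic.exists_trigPoly_norm_sub_le hI hf
      (show 0 < ε / 2 by linarith)
    obtain ⟨g, hg, x, hpg⟩ := exists_mem_ANP₀_add_const hI hp
    have hfgx : ∀ t, ‖f t - g t - x‖ ≤ ε / 2 := fun t => by
      rw [sub_sub, ← hpg]
      exact hfp t
    -- The means of `f - g - x` tend to `-x`, since those of `f` and of `g` tend to zero.
    have hx : ‖x‖ ≤ ε / 2 := by
      have hlim := ((h.sub (tendsto_meanOn_of_mem_ANP₀ hI hg)).sub_const x).norm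
      rw [sub_zero, zero_sub, norm_neg] at hlim
      refine le_of_tendsto hlim ?_
      filter_upwards [eventually_gt_atTop 0] with T hT
      exact norm_meanOn_sub_sub_le hI hfgx hT
    refine ⟨g, hg, fun t => ?_⟩
    have := norm_add_le (f t - g t - x) x
    rw [sub_add_cancel] at this
    linarith [hfgx t]
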